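/- Let $d\ge 1$ be an integer. Let $(\mathcal C,\mathbb E,\mathfrak s)$ be an extriangulated category in the sense of Nakaoka and Palu: $\mathcal C$ is an additive category, $\mathbb E:\mathcal C^{op}\times\mathcal C\to \mathrm{Ab}$ is a biadditive functor, and $\mathfrak s$ is an additive realization of $\mathbb E$ satisfying (ET3), (ET3)$^{op}$, (ET4), (ET4)$^{op}$. A sequence $A\to B\to X$ that realizes some $\delta\in\mathbb E(X,A)$ is called a conflation. An object is projective (injective) if morphisms out of it lift along the second map (morphisms into it extend along the first map) of every conflation. The category has enough projectives if every object $X$ admits a conflation $A\to P\to X$ with $P$ projective, and enough injectives if every object $A$ admits a conflation $A\to I\to X$ with $I$ injective. Put $\mathbb E^0=\mathrm{Hom}_{\mathcal C}$, $\mathbb E^1=\mathbb E$ and $\mathbb E^{n+1}(X,A)=\int^{Y\in\mathcal C}\mathbb E^{n}(X,Y)\otimes_{\mathbb Z}\mathbb E(Y,A)$ for $n\ge1$. The positive global dimension of $\mathcal C$ is the least $m\ge 0$ with $\mathbb E^{m+1}=0$ (and $\infty$ if there is none). The dominant dimension of $\mathcal C$ is the largest $n$ (possibly $\infty$) such that for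 every projective object $P$ there are $n$ conflations $Y^k\to I^k\to Y^{k+1}$, $0\le k\le n-1$, with $Y^0=P$ and all $I^k$ projective-injective. The codominant dimension is the largest $n$ (possibly $\infty$) such that for every injective object $J$ there are $n$ conflations $Y_{k+1}\to I_k\to Y_k$, $0\le k\le n-1$, with $Y_0=J$ and all $I_k$ projective-injective. The category $\mathcal C$ is called $d$-Auslander if it has enough projectives, positive global dimension at most $d+1$ and dominant dimension at least $d+1$. The opposite category $\mathcal C^{op}$ is extriangulated with $\mathbb E^{op}(X,A)=\mathbb E(A,X)$ and with the reversed conflations. Then the notion of a $d$-Auslander extriangulated category is self-dual: $\mathcal C$ is $d$-Auslander if and only if $\mathcal C^{op}$ is $d$-Auslander. Moreover, if $\mathcal C$ is $d$-Auslander, then $\mathcal C$ has enough injectives and codominant dimension at least $d+1$. -/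

import Mathlib

open CategoryTheory Opposite

universe w w' v u

namespace Extri

/-! ### Bifunctors with values in abelian groups -/

section Bifunctor

variable {C : Type u} [Category.{v} C]

/-- The abelian group `F(X, A)`, contravariant in `X` and covariant in `A`. -/
abbrev Val (F : Cᵒᵖ ⥤ C ⥤ AddCommGrpCat.{w}) (X A : C) : Type w := (F.obj (op X)).obj A

/-- `a_* : F(X, A) → F(X, A')`. -/
def push (F : Cᵒᵖ ⥤ C ⥤ AddCommGrpCat.{w}) {X A A' : C} (a : A ⟶ A') :
    Val F X A →+ Val F X A' :=
  ((F.obj (op X)).map a).hom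

/-- `c^* : F(X, A) → F(X', A)`. -/
def pull (F : Cᵒᵖ ⥤ C ⥤ AddCommGrpCat.{w}) {X X' A : C} (c : X' ⟶ X) :
    Val F X A →+ Val F X' A :=
  ((F.map c.op).app A).hom

variable (F : Cᵒᵖ ⥤ C ⥤ AddCommGrpCat.{w}) (G : Cᵒᵖ ⥤ C ⥤ AddCommGrpCat.{w'})

@[simp] lemma push_id {X A : C} (x : Val F X A) : push F (𝟙 A) x = x := by
  simp [push]

@[simp] lemma pull_id {X A : C} (x : Val F X A) : pull F (𝟙 X) x = x := by
  simp [pull]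

lemma push_comp {X A A' A'' : C} (a : A ⟶ A') (a' : A' ⟶ A'') (x : Val F X A) :
    push F (a ≫ a') x = push F a' (push F a x) := by
  simp [push]

lemma pull_comp {X X' X'' A : C} (c : X' ⟶ X) (c' : X'' ⟶ X') (x : Val F X A) :
    pull F (c' ≫ c) x = pull F c' (pull F c x) := by
  simp [pull]

lemma push_pull {X X' A A' : C} (a : A ⟶ A') (c : X' ⟶ X) (x : Val F X A) :
    push F a (pull F c x) = pull F c (push F a x) :=
  (ConcreteCategory.congr_hom ((F.map c.op).naturality a) x).symm

/-- A bifunctor is biadditive if it is additive in each of the two variables. -/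
structure IsBiadditive [Preadditive C] : Prop where
  push_add : ∀ {X A A' : C} (a a' : A ⟶ A') (x : Val F X A),
    push F (a + a') x = push F a x + push F a' x
  pull_add : ∀ {X X' A : C} (c c' : X' ⟶ X) (x : Val F X A),
    pull F (c + c') x = pull F c x + pull F c' x

/-- Generators `g ⊗ f` (with `g ∈ G(X, Y)` and `f ∈ F(Y, A)`, for varying `Y`) of the tensor
product over `C` of the functors `G(X, -)` and `F(-, A)`. -/
abbrev TensorGen (X A : C) : Type (max u w w') := Σ Y : C, Val G X Y × Val F Y A

/-- The relations between the generators: biadditivity of `⊗` and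
`u_* g ⊗ f = g ⊗ u^* f` for every morphism `u : Y ⟶ Y'` of `C`. -/
inductive TensorRel (X A : C) : FreeAbelianGroup (TensorGen F G X A) → Prop
  | add_left {Y : C} (g g' : Val G X Y) (f : Val F Y A) :
      TensorRel X A (FreeAbelianGroup.of ⟨Y, g + g', f⟩ - FreeAbelianGroup.of ⟨Y, g, f⟩
        - FreeAbelianGroup.of ⟨Y, g', f⟩)
  | add_right {Y : C} (g : Val G X Y) (f f' : Val F Y A) :
      TensorRel X A (FreeAbelianGroup.of ⟨Y, g, f + f'⟩ - FreeAbelianGroup.of ⟨Y, g, f⟩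
        - FreeAbelianGroup.of ⟨Y, g, f'⟩)
  | balanced {Y Y' : C} (m : Y ⟶ Y') (g : Val G X Y) (f : Val F Y' A) :
      TensorRel X A (FreeAbelianGroup.of ⟨Y', push G m g, f⟩
        - FreeAbelianGroup.of ⟨Y, g, pull F m f⟩)

/-- The subgroup spanned by the relations. -/
def tensorRelSubgroup (X A : C) : AddSubgroup (FreeAbelianGroup (TensorGen F G X A)) :=
  AddSubgroup.closure {r | TensorRel F G X A r}

/-- The value at `(X, A)` of the composite of bifunctors: the coend `∫^Y G(X, Y) ⊗ F(Y, A)`. -/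
abbrev TensorVal (X A : C) : Type (max u w w') :=
  FreeAbelianGroup (TensorGen F G X A) ⧸ tensorRelSubgroup F G X A

/-- The effect of a morphism `c : X' ⟶ X` and a morphism `a : A ⟶ A'` on generators. -/
def tensorGenMap {X X' A A' : C} (c : X' ⟶ X) (a : A ⟶ A') (t : TensorGen F G X A) :
    TensorGen F G X' A' :=
  ⟨t.1, pull G c t.2.1, push F a t.2.2⟩

lemma tensorRel_map {X X' A A' : C} (c : X' ⟶ X) (a : A ⟶ A') :
    tensorRelSubgroup F G X A ≤
      (tensorRelSubgroup F G X' A').comap (FreeAbelianGroup.map (tensorGenMap F G c a)) := by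
  refine (AddSubgroup.closure_le _).2 ?_
  rintro r (⟨g, g', f⟩ | ⟨g, f, f'⟩ | ⟨m, g, f⟩)
  all_goals
    refine AddSubgroup.mem_comap.2 (AddSubgroup.subset_closure ?_)
    simp only [map_sub, FreeAbelianGroup.map_of_apply, tensorGenMap, map_add, ← push_pull]
  · exact TensorRel.add_left _ _ _
  · exact TensorRel.add_right _ _ _
  · have h := TensorRel.balanced (F := F) (G := G) m (pull G c g) (push F a f)
    rw [push_pull] at h
    simpa only [push_pull, Set.mem_ofPred_eq] using h

/-- The map of tensor products `g ⊗ f ↦ c^* g ⊗ a_* f`. -/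
def tensorMap {X X' A A' : C} (c : X' ⟶ X) (a : A ⟶ A') :
    TensorVal F G X A →+ TensorVal F G X' A' :=
  QuotientAddGroup.map _ _ (FreeAbelianGroup.map (tensorGenMap F G c a)) (tensorRel_map F G c a)

lemma tensorMap_id (X A : C) : tensorMap F G (𝟙 X) (𝟙 A) = AddMonoidHom.id _ := by
  refine QuotientAddGroup.addMonoidHom_ext _ (FreeAbelianGroup.lift_ext _ _ fun t => ?_)
  simp [tensorMap, tensorGenMap]

lemma tensorMap_comp {X X' X'' A A' A'' : C} (c : X' ⟶ X) (c' : X'' ⟶ X') (a : A ⟶ A')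
    (a' : A' ⟶ A'') :
    tensorMap F G (c' ≫ c) (a ≫ a') = (tensorMap F G c' a').comp (tensorMap F G c a) := by
  refine QuotientAddGroup.addMonoidHom_ext _ (FreeAbelianGroup.lift_ext _ _ fun t => ?_)
  simp [tensorMap, tensorGenMap, push_comp, pull_comp]

/-- The composite bifunctor `(X, A) ↦ ∫^Y G(X, Y) ⊗ F(Y, A)`. -/
def tensor : Cᵒᵖ ⥤ C ⥤ AddCommGrpCat.{max u w w'} where
  obj X :=
    { obj := fun A => AddCommGrpCat.of (TensorVal F G X.unop A)
      map := fun a => AddCommGrpCat.ofHom (tensorMap F G (𝟙 X.unop) a)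
      map_id := fun A => by rw [tensorMap_id]; rfl
      map_comp := fun a a' => by
        rw [← AddCommGrpCat.ofHom_comp, ← tensorMap_comp, Category.comp_id] }
  map c :=
    { app := fun A => AddCommGrpCat.ofHom (tensorMap F G c.unop (𝟙 A))
      naturality := fun A A' a => by
        dsimp only
        rw [← AddCommGrpCat.ofHom_comp, ← AddCommGrpCat.ofHom_comp, ← tensorMap_comp,
          ← tensorMap_comp]
        simp }
  map_id X := by
    ext A : 2
    dsimp only
    rw [unop_id, tensorMap_id]
    rfl
  map_comp c c' := by
    ext A : 2
    dsimp only [NatTrans.comp_app]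
    rw [← AddCommGrpCat.ofHom_comp, ← tensorMap_comp, Category.comp_id, unop_comp]

end Bifunctor

/-! ### Extriangulated categories -/

/-- The structure `(𝔼, 𝔰)` of an extriangulated category (in the sense of Nakaoka and Palu) on an
additive category. The additive realization `𝔰` is encoded by the relation
`Realizes δ x y`, which says that the sequence `A ⟶ B ⟶ X` given by `x` and `y` belongs to the
class `𝔰(δ)`. -/
structure ExtriStr (C : Type u) [Category.{v} C] [Preadditive C] [Limits.HasZeroObject C]
    [Limits.HasBinaryBiproducts C] where
  /-- The bifunctor of extensions: `𝔼(X, A)` is `Val 𝔼 X A`. -/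
  𝔼 : Cᵒᵖ ⥤ C ⥤ AddCommGrpCat.{w}
  biadditive : IsBiadditive 𝔼
  /-- The sequence `A ⟶ B ⟶ X` realizes `δ`. -/
  Realizes : ∀ {A B X : C}, Val 𝔼 X A → (A ⟶ B) → (B ⟶ X) → Prop
  /-- Every extension is realized. -/
  exists_realizes : ∀ {A X : C} (δ : Val 𝔼 X A), ∃ (B : C) (x : A ⟶ B) (y : B ⟶ X), Realizes δ x y
  /-- The sequences that realize `δ` form exactly one equivalence class. -/
  realizes_iff : ∀ {A B B' X : C} {δ : Val 𝔼 X A} {x : A ⟶ B} {y : B ⟶ X} (x' : A ⟶ B')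
    (y' : B' ⟶ X), Realizes δ x y →
      (Realizes δ x' y' ↔ ∃ b : B ≅ B', x ≫ b.hom = x' ∧ b.hom ≫ y' = y)
  /-- Every morphism of extensions is realized by a morphism of sequences. -/
  realizes_hom : ∀ {A B X A' B' X' : C} {δ : Val 𝔼 X A} {x : A ⟶ B} {y : B ⟶ X}
    {δ' : Val 𝔼 X' A'} {x' : A' ⟶ B'} {y' : B' ⟶ X'} (a : A ⟶ A') (c : X ⟶ X'),
    Realizes δ x y → Realizes δ' x' y' → push 𝔼 a δ = pull 𝔼 c δ' →
      ∃ b : B ⟶ B', x ≫ b = a ≫ x' ∧ y ≫ c = b ≫ y'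
  /-- The zero extension is realized by the split sequence `A ⟶ A ⊕ X ⟶ X`. -/
  realizes_zero : ∀ {A X : C} (b : Limits.BinaryBicone A X), b.IsBilimit →
    Realizes (0 : Val 𝔼 X A) b.inl b.snd
  /-- The direct sum `δ ⊕ δ' ∈ 𝔼(X ⊕ X', A ⊕ A')` is realized by the direct sum of sequences. -/
  realizes_sum : ∀ {A B X A' B' X' : C} {δ : Val 𝔼 X A} {x : A ⟶ B} {y : B ⟶ X}
    {δ' : Val 𝔼 X' A'} {x' : A' ⟶ B'} {y' : B' ⟶ X'} (bA : Limits.BinaryBicone A A')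
    (bB : Limits.BinaryBicone B B') (bX : Limits.BinaryBicone X X'), bA.IsBilimit →
    bB.IsBilimit → bX.IsBilimit → Realizes δ x y → Realizes δ' x' y' →
      Realizes (push 𝔼 bA.inl (pull 𝔼 bX.fst δ) + push 𝔼 bA.inr (pull 𝔼 bX.snd δ'))
        (bA.fst ≫ x ≫ bB.inl + bA.snd ≫ x' ≫ bB.inr)
        (bB.fst ≫ y ≫ bX.inl + bB.snd ≫ y' ≫ bX.inr)
  /-- Axiom (ET3). -/
  et3 : ∀ {A B X A' B' X' : C} {δ : Val 𝔼 X A} {x : A ⟶ B} {y : B ⟶ X}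
    {δ' : Val 𝔼 X' A'} {x' : A' ⟶ B'} {y' : B' ⟶ X'} (a : A ⟶ A') (b : B ⟶ B'),
    Realizes δ x y → Realizes δ' x' y' → x ≫ b = a ≫ x' →
      ∃ c : X ⟶ X', y ≫ c = b ≫ y' ∧ push 𝔼 a δ = pull 𝔼 c δ'
  /-- Axiom (ET3)^op. -/
  et3op : ∀ {A B X A' B' X' : C} {δ : Val 𝔼 X A} {x : A ⟶ B} {y : B ⟶ X}
    {δ' : Val 𝔼 X' A'} {x' : A' ⟶ B'} {y' : B' ⟶ X'} (b : B ⟶ B') (c : X ⟶ X'),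
    Realizes δ x y → Realizes δ' x' y' → y ≫ c = b ≫ y' →
      ∃ a : A ⟶ A', x ≫ b = a ≫ x' ∧ push 𝔼 a δ = pull 𝔼 c δ'
  /-- Axiom (ET4). -/
  et4 : ∀ {A B D M F : C} {δ : Val 𝔼 D A} {f : A ⟶ B} {f' : B ⟶ D} {δ' : Val 𝔼 F B}
    {g : B ⟶ M} {g' : M ⟶ F}, Realizes δ f f' → Realizes δ' g g' →
      ∃ (E : C) (h' : M ⟶ E) (d : D ⟶ E) (e : E ⟶ F) (δ'' : Val 𝔼 E A),
        Realizes δ'' (f ≫ g) h' ∧ Realizes (push 𝔼 f' δ') d e ∧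
        g ≫ h' = f' ≫ d ∧ h' ≫ e = g' ∧
        pull 𝔼 d δ'' = δ ∧ push 𝔼 f δ'' = pull 𝔼 e δ'
  /-- Axiom (ET4)^op. -/
  et4op : ∀ {A B D M F : C} {δ : Val 𝔼 B D} {f' : D ⟶ A} {f : A ⟶ B} {δ' : Val 𝔼 M F}
    {g' : F ⟶ B} {g : B ⟶ M}, Realizes δ f' f → Realizes δ' g' g →
      ∃ (E : C) (h' : E ⟶ A) (d : D ⟶ E) (e : E ⟶ F) (δ'' : Val 𝔼 M E),
        Realizes δ'' h' (f ≫ g) ∧ Realizes (pull 𝔼 g' δ) d e ∧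
        h' ≫ f = e ≫ g' ∧ d ≫ h' = f' ∧
        push 𝔼 e δ'' = δ' ∧ push 𝔼 d δ = pull 𝔼 g δ''

namespace ExtriStr

variable {C : Type u} [Category.{v} C] [Preadditive C] [Limits.HasZeroObject C]
  [Limits.HasBinaryBiproducts C]

/-- A binary bicone in the opposite category, seen in the category itself. -/
def bilimitUnop {X Y : Cᵒᵖ} (b : Limits.BinaryBicone X Y) :
    Limits.BinaryBicone X.unop Y.unop where
  pt := b.pt.unop
  fst := b.inl.unop
  snd := b.inr.unop
  inl := b.fst.unop
  inr := b.snd.unop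
  inl_fst := by rw [← unop_comp, b.inl_fst, unop_id]
  inl_snd := by rw [← unop_comp, b.inr_fst]; rfl
  inr_fst := by rw [← unop_comp, b.inl_snd]; rfl
  inr_snd := by rw [← unop_comp, b.inr_snd, unop_id]

/-- It is a bilimit if the given bicone is one. -/
def bilimitUnopIsBilimit {X Y : Cᵒᵖ} {b : Limits.BinaryBicone X Y} (hb : b.IsBilimit) :
    (bilimitUnop b).IsBilimit :=
  Limits.isBinaryBilimitOfTotal _ (by
    have h := congrArg Quiver.Hom.unop (Limits.IsBilimit.binary_total hb)
    simp only [unop_add, unop_comp, unop_id] at h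
    exact h)

/-- The same with the two summands exchanged. -/
def bilimitUnopSwap {X Y : Cᵒᵖ} (b : Limits.BinaryBicone X Y) :
    Limits.BinaryBicone Y.unop X.unop where
  pt := b.pt.unop
  fst := b.inr.unop
  snd := b.inl.unop
  inl := b.snd.unop
  inr := b.fst.unop
  inl_fst := by rw [← unop_comp, b.inr_snd, unop_id]
  inl_snd := by rw [← unop_comp, b.inl_snd]; rfl
  inr_fst := by rw [← unop_comp, b.inr_fst]; rfl
  inr_snd := by rw [← unop_comp, b.inl_fst, unop_id]

/-- It is a bilimit if the given bicone is one. -/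
def bilimitUnopSwapIsBilimit {X Y : Cᵒᵖ} {b : Limits.BinaryBicone X Y} (hb : b.IsBilimit) :
    (bilimitUnopSwap b).IsBilimit :=
  Limits.isBinaryBilimitOfTotal _ (by
    have h := congrArg Quiver.Hom.unop (Limits.IsBilimit.binary_total hb)
    rw [add_comm] at h
    simp only [unop_add, unop_comp, unop_id] at h
    exact h)

/-- The opposite extriangulated category: `𝔼ᵒᵖ(X, A) = 𝔼(A, X)`, and a sequence realizes `δ` in
the opposite category if and only if the reversed sequence realizes `δ` in the category. -/
def op (𝒞 : ExtriStr.{w} C) : ExtriStr.{w} Cᵒᵖ where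
  𝔼 := unopUnop C ⋙ 𝒞.𝔼.flip
  biadditive :=
    { push_add := fun a a' x => 𝒞.biadditive.pull_add a.unop a'.unop x
      pull_add := fun c c' x => 𝒞.biadditive.push_add c.unop c'.unop x }
  Realizes δ x y := 𝒞.Realizes δ y.unop x.unop
  exists_realizes δ := by
    obtain ⟨B, x, y, h⟩ := 𝒞.exists_realizes δ
    exact ⟨Opposite.op B, y.op, x.op, h⟩
  realizes_iff x' y' h := by
    refine (𝒞.realizes_iff y'.unop x'.unop h).trans ⟨?_, ?_⟩
    · rintro ⟨b, h1, h2⟩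
      refine ⟨b.symm.op, Quiver.Hom.unop_inj ?_, Quiver.Hom.unop_inj ?_⟩
      · simp [← h2]
      · simp [← h1]
    · rintro ⟨b, h1, h2⟩
      refine ⟨b.symm.unop, ?_, ?_⟩
      · simp [← h2]
      · simp [← h1]
  realizes_hom a c h h' e := by
    obtain ⟨b, h1, h2⟩ := 𝒞.realizes_hom c.unop a.unop h' h e.symm
    exact ⟨b.op, Quiver.Hom.unop_inj h2.symm, Quiver.Hom.unop_inj h1.symm⟩
  realizes_zero b hb := 𝒞.realizes_zero (bilimitUnopSwap b) (bilimitUnopSwapIsBilimit hb)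
  realizes_sum {A B X A' B' X' δ x y δ' x' y'} bA bB bX hA hB hX h h' := by
    have key := 𝒞.realizes_sum (bilimitUnop bX) (bilimitUnop bB) (bilimitUnop bA)
      (bilimitUnopIsBilimit hX) (bilimitUnopIsBilimit hB) (bilimitUnopIsBilimit hA) h h'
    rw [push_pull, push_pull] at key
    have e1 : (bA.fst ≫ x ≫ bB.inl + bA.snd ≫ x' ≫ bB.inr).unop =
        (bilimitUnop bB).fst ≫ x.unop ≫ (bilimitUnop bA).inl +
          (bilimitUnop bB).snd ≫ x'.unop ≫ (bilimitUnop bA).inr := by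
      simp only [unop_add, unop_comp, Category.assoc]
      rfl
    have e2 : (bB.fst ≫ y ≫ bX.inl + bB.snd ≫ y' ≫ bX.inr).unop =
        (bilimitUnop bX).fst ≫ y.unop ≫ (bilimitUnop bB).inl +
          (bilimitUnop bX).snd ≫ y'.unop ≫ (bilimitUnop bB).inr := by
      simp only [unop_add, unop_comp, Category.assoc]
      rfl
    rw [e1, e2]
    exact key
  et3 a b h h' e := by
    obtain ⟨c, h1, h2⟩ := 𝒞.et3op b.unop a.unop h' h (congrArg Quiver.Hom.unop e).symm
    exact ⟨c.op, Quiver.Hom.unop_inj h1.symm, h2.symm⟩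
  et3op b c h h' e := by
    obtain ⟨a, h1, h2⟩ := 𝒞.et3 c.unop b.unop h' h (congrArg Quiver.Hom.unop e).symm
    exact ⟨a.op, Quiver.Hom.unop_inj h1.symm, h2.symm⟩
  et4 h h' := by
    obtain ⟨E, k, d, e, δ'', h1, h2, h3, h4, h5, h6⟩ := 𝒞.et4op h' h
    exact ⟨Opposite.op E, k.op, e.op, d.op, δ'', h1, h2, Quiver.Hom.unop_inj h3,
      Quiver.Hom.unop_inj h4, h5, h6.symm⟩
  et4op h h' := by
    obtain ⟨E, k, d, e, δ'', h1, h2, h3, h4, h5, h6⟩ := 𝒞.et4 h' h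
    exact ⟨Opposite.op E, k.op, e.op, d.op, δ'', h1, h2, Quiver.Hom.unop_inj h3,
      Quiver.Hom.unop_inj h4, h5, h6.symm⟩

variable (𝒞 : ExtriStr.{w} C)

/-- `A ⟶ B ⟶ X` is a conflation: it realizes some extension. -/
def IsConflation {A B X : C} (x : A ⟶ B) (y : B ⟶ X) : Prop :=
  ∃ δ : Val 𝒞.𝔼 X A, 𝒞.Realizes δ x y

/-- `P` is projective: morphisms from `P` lift along the second map of every conflation. -/
def IsProjective (P : C) : Prop :=
  ∀ ⦃A B X : C⦄ (x : A ⟶ B) (y : B ⟶ X), 𝒞.IsConflation x y →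
    ∀ c : P ⟶ X, ∃ b : P ⟶ B, b ≫ y = c

/-- `I` is injective: morphisms to `I` extend along the first map of every conflation. -/
def IsInjective (I : C) : Prop :=
  ∀ ⦃A B X : C⦄ (x : A ⟶ B) (y : B ⟶ X), 𝒞.IsConflation x y →
    ∀ a : A ⟶ I, ∃ b : B ⟶ I, x ≫ b = a

/-- Every object `X` has a conflation `A ⟶ P ⟶ X` with `P` projective. -/
def EnoughProjectives : Prop :=
  ∀ X : C, ∃ (A P : C) (x : A ⟶ P) (y : P ⟶ X), 𝒞.IsConflation x y ∧ 𝒞.IsProjective P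

/-- Every object `A` has a conflation `A ⟶ I ⟶ X` with `I` injective. -/
def EnoughInjectives : Prop :=
  ∀ A : C, ∃ (I X : C) (x : A ⟶ I) (y : I ⟶ X), 𝒞.IsConflation x y ∧ 𝒞.IsInjective I

/-- The higher extension bifunctors: `𝔼⁰ = Hom`, `𝔼¹ = 𝔼`, and
`𝔼ⁿ⁺¹(X, A) = ∫^Y 𝔼ⁿ(X, Y) ⊗ 𝔼(Y, A)` for `n ≥ 1`. -/
noncomputable def higherExt : ℕ → (Cᵒᵖ ⥤ C ⥤ AddCommGrpCat.{max u v w})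
  | 0 => preadditiveCoyoneda ⋙
      (Functor.whiskeringRight C _ _).obj AddCommGrpCat.uliftFunctor.{max u w, v}
  | 1 => 𝒞.𝔼 ⋙ (Functor.whiskeringRight C _ _).obj AddCommGrpCat.uliftFunctor.{max u v, w}
  | n + 2 => tensor 𝒞.𝔼 (higherExt (n + 1))

/-- `𝔼ⁿ = 0`. -/
def HigherExtVanishes (n : ℕ) : Prop := ∀ X A : C, Subsingleton (Val (𝒞.higherExt n) X A)

/-- The positive global dimension: the least `m` with `𝔼ᵐ⁺¹ = 0`, and `∞` if there is none. -/
noncomputable def posGlobalDim : ℕ∞ :=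
  sInf {m : ℕ∞ | ∃ k : ℕ, m = k ∧ 𝒞.HigherExtVanishes (k + 1)}

/-- There are `n` conflations `Yᵏ ⟶ Iᵏ ⟶ Yᵏ⁺¹`, `0 ≤ k < n`, with `Y⁰ = Y` and every `Iᵏ`
projective and injective. -/
def HasProjInjCoresolution : ℕ → C → Prop
  | 0, _ => True
  | n + 1, Y => ∃ (I Y' : C) (f : Y ⟶ I) (g : I ⟶ Y'), 𝒞.IsConflation f g ∧
      𝒞.IsProjective I ∧ 𝒞.IsInjective I ∧ HasProjInjCoresolution n Y'

/-- There are `n` conflations `Yₖ₊₁ ⟶ Iₖ ⟶ Yₖ`, `0 ≤ k < n`, with `Y₀ = Y` and every `Iₖ`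
projective and injective. -/
def HasProjInjResolution : ℕ → C → Prop
  | 0, _ => True
  | n + 1, Y => ∃ (Y' I : C) (f : Y' ⟶ I) (g : I ⟶ Y), 𝒞.IsConflation f g ∧
      𝒞.IsProjective I ∧ 𝒞.IsInjective I ∧ HasProjInjResolution n Y'

/-- The dominant dimension: the largest `n` such that every projective object has a coresolution
by `n` projective-injective objects, and `∞` if there is no largest one. -/
noncomputable def domDim : ℕ∞ :=
  sSup {m : ℕ∞ | ∃ n : ℕ, m = n ∧ ∀ P : C, 𝒞.IsProjective P → 𝒞.HasProjInjCoresolution n P}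

/-- The codominant dimension: the largest `n` such that every injective object has a resolution
by `n` projective-injective objects, and `∞` if there is no largest one. -/
noncomputable def codomDim : ℕ∞ :=
  sSup {m : ℕ∞ | ∃ n : ℕ, m = n ∧ ∀ I : C, 𝒞.IsInjective I → 𝒞.HasProjInjResolution n I}

/-- A `d`-Auslander extriangulated category. -/
structure IsAuslander (d : ℕ) : Prop where
  enoughProjectives : 𝒞.EnoughProjectives
  posGlobalDim_le : 𝒞.posGlobalDim ≤ d + 1
  le_domDim : d + 1 ≤ 𝒞.domDim

end ExtriStr

end Extri

/-! With enough projectives, 𝔼ⁿ⁺²(X, -) vanishes exactly when 𝔼ⁿ⁺¹(Z, -) does for a syzygy Z of X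
(`IsConflation.extVanishesAt_succ_iff`). Hence being d-Auslander means: enough projectives, (d+1)-st
syzygies are projective, and projectives have d+1 steps of projective-injective coresolution
(`isAuslander_iff`). The dual of each condition is then derived.

Dimension shifting trades cosyzygies in the second argument of 𝔼 for syzygies in the first, so
(d+1)-st cosyzygies are injective (`IsCosyzygy.isInjective`). Projectives therefore have injective
coresolutions of every length. This property passes to cones of inflations
(`HasInjCoresolution.cone`), hence by descending induction on syzygy order to every object, which
gives enough injectives.

For an injective M, take a deflation P ⟶ M with P projective and embed P in a projective-injective I
with cone Y. By (ET4) the pushout of M and I is an extension of Y by M; it splits, so I maps onto M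
by a deflation. The kernel K satisfies a weaker vanishing of 𝔼(-, K), still enough to repeat the
step d+1 times (`EnoughProjectives.hasProjInjResolution`). -/

namespace Extri

namespace ExtriStr

variable {C : Type u} [Category.{v} C] [Preadditive C] [Limits.HasZeroObject C]
  [Limits.HasBinaryBiproducts C] (𝒞 : ExtriStr.{w} C)

open scoped ZeroObject

/-! ### Exactness -/

lemma pull_zero {X X' A : C} (δ : Val 𝒞.𝔼 X A) : pull 𝒞.𝔼 (0 : X' ⟶ X) δ = 0 := by
  have h := 𝒞.biadditive.pull_add (0 : X' ⟶ X) 0 δ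
  rwa [add_zero, left_eq_add] at h

lemma push_sub {X A A' : C} (a a' : A ⟶ A') (δ : Val 𝒞.𝔼 X A) :
    push 𝒞.𝔼 (a - a') δ = push 𝒞.𝔼 a δ - push 𝒞.𝔼 a' δ := by
  rw [eq_sub_iff_add_eq, ← 𝒞.biadditive.push_add, sub_add_cancel]

lemma pull_sub {X X' A : C} (c c' : X' ⟶ X) (δ : Val 𝒞.𝔼 X A) :
    pull 𝒞.𝔼 (c - c') δ = pull 𝒞.𝔼 c δ - pull 𝒞.𝔼 c' δ := by
  rw [eq_sub_iff_add_eq, ← 𝒞.biadditive.pull_add, sub_add_cancel]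

/-- `0` as the second summand of `B`. -/
noncomputable def biconeZeroRight (B : C) : Limits.BinaryBicone B (0 : C) where
  pt := B
  fst := 𝟙 B
  snd := 0
  inl := 𝟙 B
  inr := 0
  inr_snd := (Limits.isZero_zero C).eq_of_src _ _

/-- It is a bilimit. -/
noncomputable def biconeZeroRightIsBilimit (B : C) : (biconeZeroRight B).IsBilimit :=
  Limits.isBinaryBilimitOfTotal _ (by
    simp only [biconeZeroRight, Category.comp_id, Limits.comp_zero]
    exact add_zero _)

/-- `0` as the first summand of `B`. -/
noncomputable def biconeZeroLeft (B : C) : Limits.BinaryBicone (0 : C) B where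
  pt := B
  fst := 0
  snd := 𝟙 B
  inl := 0
  inr := 𝟙 B
  inl_fst := (Limits.isZero_zero C).eq_of_src _ _

/-- It is a bilimit. -/
noncomputable def biconeZeroLeftIsBilimit (B : C) : (biconeZeroLeft B).IsBilimit :=
  Limits.isBinaryBilimitOfTotal _ (by
    simp only [biconeZeroLeft, Category.comp_id, Limits.comp_zero]
    exact zero_add _)

lemma realizes_id_zero (B : C) : 𝒞.Realizes (0 : Val 𝒞.𝔼 (0 : C) B) (𝟙 B) 0 :=
  𝒞.realizes_zero _ (biconeZeroRightIsBilimit B)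

lemma realizes_zero_id (B : C) : 𝒞.Realizes (0 : Val 𝒞.𝔼 B (0 : C)) 0 (𝟙 B) :=
  𝒞.realizes_zero _ (biconeZeroLeftIsBilimit B)

variable {𝒞}

/-- (ET3) compares the conflation with B = B ⟶ 0, whose extension class is zero. -/
lemma Realizes.push_inflation {A B X : C} {δ : Val 𝒞.𝔼 X A} {x : A ⟶ B} {y : B ⟶ X}
    (h : 𝒞.Realizes δ x y) : push 𝒞.𝔼 x δ = 0 := by
  obtain ⟨c, -, hc⟩ := 𝒞.et3 x (𝟙 B) h (𝒞.realizes_id_zero B) rfl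
  rw [hc, map_zero]

lemma Realizes.pull_deflation {A B X : C} {δ : Val 𝒞.𝔼 X A} {x : A ⟶ B} {y : B ⟶ X}
    (h : 𝒞.Realizes δ x y) : pull 𝒞.𝔼 y δ = 0 := by
  obtain ⟨a, -, ha⟩ := 𝒞.et3op (𝟙 B) y (𝒞.realizes_zero_id B) h rfl
  rw [← ha, map_zero]

lemma Realizes.exists_extend {A B X Y : C} {δ : Val 𝒞.𝔼 X A} {x : A ⟶ B} {y : B ⟶ X}
    (h : 𝒞.Realizes δ x y) (a : A ⟶ Y) (ha : push 𝒞.𝔼 a δ = 0) : ∃ b : B ⟶ Y, x ≫ b = a := by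
  obtain ⟨b, hb, -⟩ := 𝒞.realizes_hom a (0 : X ⟶ 0) h (𝒞.realizes_id_zero Y)
    (by rw [ha, map_zero])
  exact ⟨b, by rw [hb, Category.comp_id]⟩

lemma Realizes.exists_lift {A B X Y : C} {δ : Val 𝒞.𝔼 X A} {x : A ⟶ B} {y : B ⟶ X}
    (h : 𝒞.Realizes δ x y) (c : Y ⟶ X) (hc : pull 𝒞.𝔼 c δ = 0) : ∃ b : Y ⟶ B, b ≫ y = c := by
  obtain ⟨b, -, hb⟩ := 𝒞.realizes_hom (0 : 0 ⟶ A) c (𝒞.realizes_zero_id Y) h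
    (by rw [hc, map_zero])
  exact ⟨b, by rw [← hb, Category.id_comp]⟩

/-- Exactness at 𝔼(X, Y): since y^*g = 0, y lifts through a realization of g, and (ET3)^op completes
this lift and 𝟙 X to a morphism of conflations. -/
lemma Realizes.exists_eq_push {A B X Y : C} {δ : Val 𝒞.𝔼 X A} {x : A ⟶ B} {y : B ⟶ X}
    (h : 𝒞.Realizes δ x y) (g : Val 𝒞.𝔼 X Y) (hg : pull 𝒞.𝔼 y g = 0) :
    ∃ a : A ⟶ Y, push 𝒞.𝔼 a δ = g := by
  obtain ⟨E, x', y', h'⟩ := 𝒞.exists_realizes g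
  obtain ⟨b, hb⟩ := h'.exists_lift y hg
  obtain ⟨a, -, ha⟩ := 𝒞.et3op b (𝟙 X) h h' (by rw [hb, Category.comp_id])
  exact ⟨a, by rw [ha, pull_id]⟩

lemma Realizes.exists_eq_pull {A B X Y : C} {δ : Val 𝒞.𝔼 X A} {x : A ⟶ B} {y : B ⟶ X}
    (h : 𝒞.Realizes δ x y) (g : Val 𝒞.𝔼 Y A) (hg : push 𝒞.𝔼 x g = 0) :
    ∃ c : Y ⟶ X, pull 𝒞.𝔼 c δ = g := by
  obtain ⟨E, x', y', h'⟩ := 𝒞.exists_realizes g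
  obtain ⟨b, hb⟩ := h'.exists_extend x hg
  obtain ⟨c, -, hc⟩ := 𝒞.et3 (𝟙 A) b h' h (by rw [hb, Category.id_comp])
  exact ⟨c, by rw [← hc, push_id]⟩

lemma Realizes.exists_desc {A B X Y : C} {δ : Val 𝒞.𝔼 X A} {x : A ⟶ B} {y : B ⟶ X}
    (h : 𝒞.Realizes δ x y) (b : B ⟶ Y) (hb : x ≫ b = 0) : ∃ c : X ⟶ Y, y ≫ c = b := by
  obtain ⟨c, hc, -⟩ := 𝒞.et3 (0 : A ⟶ 0) b h (𝒞.realizes_zero_id Y) (by rw [hb, Limits.zero_comp])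
  exact ⟨c, by rw [hc, Category.comp_id]⟩

/-- The difference e - 1 factors through y and is killed by y afterwards, so it squares to zero and
2 - e inverts e. -/
lemma Realizes.isIso_of_comp_eq {A B X : C} {δ : Val 𝒞.𝔼 X A} {x : A ⟶ B} {y : B ⟶ X}
    (h : 𝒞.Realizes δ x y) (e : B ⟶ B) (hx : x ≫ e = x) (hy : e ≫ y = y) : IsIso e := by
  obtain ⟨c, hc⟩ := h.exists_desc (e - 𝟙 B) (by simp [hx])
  have h2 : (e - 𝟙 B) ≫ (e - 𝟙 B) = 0 := by
    nth_rw 2 [← hc]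
    simp [Preadditive.sub_comp, reassoc_of% hy]
  simp only [Preadditive.sub_comp, Preadditive.comp_sub, Category.id_comp, Category.comp_id] at h2
  refine ⟨𝟙 B + 𝟙 B - e, ?_, ?_⟩ <;>
    simp only [Preadditive.sub_comp, Preadditive.comp_sub, Preadditive.comp_add,
      Preadditive.add_comp, Category.id_comp, Category.comp_id] <;>
    rw [← sub_eq_zero, ← neg_eq_zero, ← h2] <;> abel

/-- The equivalence of realizations fixes both end terms, so changing A needs an argument: any
realization of the pushed class receives and emits comparison maps whose composites are
isomorphisms. -/
lemma Realizes.push_iso {A A' B X : C} {δ : Val 𝒞.𝔼 X A} {x : A ⟶ B} {y : B ⟶ X}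
    (h : 𝒞.Realizes δ x y) (a : A ≅ A') : 𝒞.Realizes (push 𝒞.𝔼 a.hom δ) (a.inv ≫ x) y := by
  obtain ⟨B', x', y', h'⟩ := 𝒞.exists_realizes (push 𝒞.𝔼 a.hom δ)
  obtain ⟨b, hb1, hb2⟩ := 𝒞.realizes_hom a.hom (𝟙 X) h h' (by rw [pull_id])
  obtain ⟨b', hb1', hb2'⟩ := 𝒞.realizes_hom a.inv (𝟙 X) h' h
    (by rw [pull_id, ← push_comp, a.hom_inv_id, push_id])
  rw [Category.comp_id] at hb2 hb2'
  have i1 := h.isIso_of_comp_eq (b ≫ b') (by simp [reassoc_of% hb1, hb1'])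
    (by rw [Category.assoc, ← hb2', ← hb2])
  have i2 := h'.isIso_of_comp_eq (b' ≫ b) (by simp [reassoc_of% hb1', hb1])
    (by rw [Category.assoc, ← hb2, ← hb2'])
  have : IsIso b := by
    have : IsSplitMono b := IsSplitMono.mk' ⟨b' ≫ inv (b ≫ b'), by
      rw [← Category.assoc, IsIso.hom_inv_id]⟩
    have : Epi b := epi_of_epi b' b
    exact isIso_of_epi_of_isSplitMono b
  exact (𝒞.realizes_iff _ _ h').2 ⟨(asIso b).symm,
    by simp [IsIso.comp_inv_eq, hb1], by simp [hb2]⟩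

/-! ### Projective and injective objects -/

lemma IsProjective.eq_zero {P A : C} (hP : 𝒞.IsProjective P) (δ : Val 𝒞.𝔼 P A) : δ = 0 := by
  obtain ⟨B, x, y, h⟩ := 𝒞.exists_realizes δ
  obtain ⟨s, hs⟩ := hP x y ⟨δ, h⟩ (𝟙 P)
  rw [← pull_id _ δ, ← hs, pull_comp, h.pull_deflation, map_zero]

lemma IsInjective.eq_zero {I X : C} (hI : 𝒞.IsInjective I) (δ : Val 𝒞.𝔼 X I) : δ = 0 := by
  obtain ⟨B, x, y, h⟩ := 𝒞.exists_realizes δ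
  obtain ⟨s, hs⟩ := hI x y ⟨δ, h⟩ (𝟙 I)
  rw [← push_id _ δ, ← hs, push_comp, h.push_inflation, map_zero]

lemma isProjective_of_eq_zero {P : C} (hP : ∀ (A : C) (δ : Val 𝒞.𝔼 P A), δ = 0) :
    𝒞.IsProjective P := fun _ _ _ _ _ ⟨_, h⟩ c => h.exists_lift c (hP _ _)

lemma isInjective_of_eq_zero {I : C} (hI : ∀ (X : C) (δ : Val 𝒞.𝔼 X I), δ = 0) :
    𝒞.IsInjective I := fun _ _ _ _ _ ⟨_, h⟩ a => h.exists_extend a (hI _ _)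

lemma isInjective_zero : 𝒞.IsInjective (0 : C) := fun _ _ _ _ _ _ _ =>
  ⟨0, (Limits.isZero_zero C).eq_of_tgt _ _⟩

lemma IsInjective.biprod {I K : C} (hI : 𝒞.IsInjective I) (hK : 𝒞.IsInjective K) :
    𝒞.IsInjective (I ⊞ K) := fun _ _ _ x y h a => by
  obtain ⟨b, hb⟩ := hI x y h (a ≫ Limits.biprod.fst)
  obtain ⟨b', hb'⟩ := hK x y h (a ≫ Limits.biprod.snd)
  exact ⟨Limits.biprod.lift b b', by ext <;> simp [hb, hb']⟩

/-- Dimension shifting: if `𝔼(Z, W) = 0` then `𝔼(Z', W') = 0`, where `Z` is a syzygy of `Z'` and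
`W'` is a cosyzygy of `W`. -/
lemma eq_zero_shift_up {Z P Z' W I W' : C} {z : Z ⟶ P} {z' : P ⟶ Z'} {i : W ⟶ I} {i' : I ⟶ W'}
    (hz : 𝒞.IsConflation z z') (hP : 𝒞.IsProjective P) (hi : 𝒞.IsConflation i i')
    (hI : 𝒞.IsInjective I) (h : ∀ δ : Val 𝒞.𝔼 Z W, δ = 0) (g : Val 𝒞.𝔼 Z' W') : g = 0 := by
  -- The class g is a_*ε for some a : Z ⟶ W'. Vanishing of 𝔼(Z, W) lifts a to I, and injectivity of
  -- I extends the lift over P; so a factors through z and kills ε.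
  obtain ⟨ε, hε⟩ := hz
  obtain ⟨κ, hκ⟩ := hi
  obtain ⟨a, rfl⟩ := hε.exists_eq_push g (hP.eq_zero _)
  obtain ⟨b, rfl⟩ := hκ.exists_lift a (h _)
  obtain ⟨c, rfl⟩ := hI z z' ⟨ε, hε⟩ b
  rw [Category.assoc, push_comp, hε.push_inflation, map_zero]

/-- Dimension shifting: if `𝔼(Z', W') = 0` then `𝔼(Z, W) = 0`, where `Z` is a syzygy of `Z'` and
`W'` is a cosyzygy of `W`. -/
lemma eq_zero_shift_down {Z P Z' W I W' : C} {z : Z ⟶ P} {z' : P ⟶ Z'} {i : W ⟶ I} {i' : I ⟶ W'}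
    (hz : 𝒞.IsConflation z z') (hP : 𝒞.IsProjective P) (hi : 𝒞.IsConflation i i')
    (hI : 𝒞.IsInjective I) (h : ∀ δ : Val 𝒞.𝔼 Z' W', δ = 0) (g : Val 𝒞.𝔼 Z W) : g = 0 := by
  -- Dually, g is c^*κ for some c : Z ⟶ W', which extends over P by the vanishing and then lifts to
  -- I by projectivity.
  obtain ⟨ε, hε⟩ := hz
  obtain ⟨κ, hκ⟩ := hi
  obtain ⟨c, rfl⟩ := hκ.exists_eq_pull g (hI.eq_zero _)
  obtain ⟨b, rfl⟩ := hε.exists_extend c (h _)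
  obtain ⟨a, rfl⟩ := hP i i' ⟨κ, hκ⟩ b
  rw [← Category.assoc, pull_comp, hκ.pull_deflation, map_zero]

/-! ### Split conflations, sums and pushouts -/

/-- A sequence that realizes the zero extension is the sequence of a bilimit bicone. -/
lemma Realizes.exists_bicone {A M X : C} {x : A ⟶ M} {y : M ⟶ X}
    (h : 𝒞.Realizes (0 : Val 𝒞.𝔼 X A) x y) :
    ∃ (r : M ⟶ A) (s : X ⟶ M) (h1 : x ≫ r = 𝟙 A) (h2 : x ≫ y = 0) (h3 : s ≫ r = 0)
      (h4 : s ≫ y = 𝟙 X),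
      Nonempty (Limits.BinaryBicone.IsBilimit ⟨M, r, y, x, s, h1, h2, h3, h4⟩) := by
  obtain ⟨e, rfl, he⟩ := (𝒞.realizes_iff x y
    (𝒞.realizes_zero _ (Limits.BinaryBiproduct.isBilimit A X))).1 h
  have he' : y = e.inv ≫ Limits.biprod.snd := (Iso.eq_inv_comp e).2 he
  subst he'
  refine ⟨e.inv ≫ Limits.biprod.fst, Limits.biprod.inr ≫ e.hom, by simp, by simp, by simp,
    by simp, ⟨Limits.isBinaryBilimitOfTotal _ ?_⟩⟩
  have := congrArg (fun f => e.inv ≫ f ≫ e.hom) (Limits.biprod.total (X := A) (Y := X))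
  simpa only [Preadditive.add_comp, Preadditive.comp_add, Category.assoc, Category.id_comp,
    e.inv_hom_id] using this

/-- The summands of a split conflation can be exchanged. -/
lemma Realizes.exists_swap {A M X : C} {x : A ⟶ M} {y : M ⟶ X}
    (h : 𝒞.Realizes (0 : Val 𝒞.𝔼 X A) x y) :
    ∃ (s : X ⟶ M) (r : M ⟶ A), 𝒞.Realizes (0 : Val 𝒞.𝔼 A X) s r := by
  obtain ⟨r, s, h1, h2, h3, h4, ⟨hb⟩⟩ := h.exists_bicone
  refine ⟨s, r, 𝒞.realizes_zero ⟨M, y, r, s, x, h4, h3, h2, h1⟩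
    (Limits.isBinaryBilimitOfTotal _ ?_)⟩
  have := Limits.IsBilimit.binary_total hb
  rwa [add_comm] at this

/-- If `M = I ⊕ X` and `X ⟶ K ⟶ X'` is a conflation, there is a conflation
`M ⟶ I ⊕ K ⟶ X'`. -/
lemma exists_isConflation_biprod {I M X K X' : C} {i : I ⟶ M} {p : M ⟶ X} {k : X ⟶ K}
    {q : K ⟶ X'} (h : 𝒞.Realizes (0 : Val 𝒞.𝔼 X I) i p) (hk : 𝒞.IsConflation k q) :
    ∃ (x : M ⟶ I ⊞ K) (y : I ⊞ K ⟶ X'), 𝒞.IsConflation x y := by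
  obtain ⟨r, s, h1, h2, h3, h4, ⟨hb⟩⟩ := h.exists_bicone
  obtain ⟨κ, hκ⟩ := hk
  -- This is the direct sum of I = I ⟶ 0 with the given conflation.
  exact ⟨_, _, _, 𝒞.realizes_sum _ _ _ hb (Limits.BinaryBiproduct.isBilimit I K)
    (biconeZeroLeftIsBilimit X') (𝒞.realizes_id_zero I) hκ⟩

/-- By (ET4)^op the kernel of M ⟶ S ⟶ Y realizes j^*θ = δ, so it is isomorphic to B. -/
lemma exists_isConflation_of_pull_inl {A B X Y : C} {δ : Val 𝒞.𝔼 X A} {x : A ⟶ B} {y : B ⟶ X}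
    (hδ : 𝒞.Realizes δ x y) {M S : C} {j : X ⟶ S} {q : S ⟶ Y}
    (hS : 𝒞.Realizes (0 : Val 𝒞.𝔼 Y X) j q) {θ : Val 𝒞.𝔼 S A} {m : A ⟶ M} {n : M ⟶ S}
    (hθ : 𝒞.Realizes θ m n) (hj : pull 𝒞.𝔼 j θ = δ) :
    ∃ (b : B ⟶ M) (c : M ⟶ Y), 𝒞.IsConflation b c := by
  obtain ⟨E, k, d, e, δ'', h1, h2, -, -, -, -⟩ := 𝒞.et4op hθ hS
  rw [hj] at h2
  obtain ⟨f, -, -⟩ := (𝒞.realizes_iff x y h2).1 hδ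
  exact ⟨_, _, _, h1.push_iso f⟩

/-- The pushout of two inflations with the same source. -/
lemma exists_pushout {A B X I Y : C} {x : A ⟶ B} {y : B ⟶ X} {i : A ⟶ I} {p : I ⟶ Y}
    (h : 𝒞.IsConflation x y) (h' : 𝒞.IsConflation i p) :
    ∃ (M : C) (b : B ⟶ M) (c : M ⟶ Y) (b' : I ⟶ M) (c' : M ⟶ X),
      𝒞.IsConflation b c ∧ 𝒞.IsConflation b' c' := by
  obtain ⟨δ, hδ⟩ := h
  obtain ⟨ε, hε⟩ := h'
  -- The pushout realizes the class on X ⊞ Y that restricts to δ on X and to ε on Y.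
  obtain ⟨M, m, n, hθ⟩ := 𝒞.exists_realizes (X := X ⊞ Y)
    (pull 𝒞.𝔼 Limits.biprod.fst δ + pull 𝒞.𝔼 Limits.biprod.snd ε)
  have hS := 𝒞.realizes_zero _ (Limits.BinaryBiproduct.isBilimit X Y)
  have hS' : 𝒞.Realizes (0 : Val 𝒞.𝔼 X Y) (Limits.biprod.inr : Y ⟶ X ⊞ Y) Limits.biprod.fst :=
    𝒞.realizes_zero ⟨X ⊞ Y, Limits.biprod.snd, Limits.biprod.fst, Limits.biprod.inr,
      Limits.biprod.inl, by simp, by simp, by simp, by simp⟩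
      (Limits.isBinaryBilimitOfTotal _ (by simp [add_comm]))
  obtain ⟨b, c, hc⟩ := exists_isConflation_of_pull_inl hδ hS hθ (by
    simp only [map_add, Limits.BinaryBiproduct.bicone_inl]
    rw [← pull_comp, ← pull_comp]
    simp [pull_zero])
  obtain ⟨b', c', hc'⟩ := exists_isConflation_of_pull_inl hε hS' hθ (by
    simp only [map_add]
    rw [← pull_comp, ← pull_comp]
    simp [pull_zero])
  exact ⟨M, b, c, b', c', hc, hc'⟩

end ExtriStr

end Extri

namespace Extri

/-! ### Maps between tensor products -/

section TensorLeft

variable {C : Type u} [Category.{v} C] {F : Cᵒᵖ ⥤ C ⥤ AddCommGrpCat.{w}}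
  {G : Cᵒᵖ ⥤ C ⥤ AddCommGrpCat.{w'}}

/-- The generator `g ⊗ f`. -/
def tmk {X A : C} (Y : C) (g : Val G X Y) (f : Val F Y A) : Val (tensor F G) X A :=
  QuotientAddGroup.mk (s := tensorRelSubgroup F G X A) (FreeAbelianGroup.of ⟨Y, g, f⟩)

lemma tensorMk_eq_of_rel {X A : C} {r : FreeAbelianGroup (TensorGen F G X A)}
    (h : TensorRel F G X A r) : QuotientAddGroup.mk (s := tensorRelSubgroup F G X A) r = 0 :=
  (QuotientAddGroup.eq_zero_iff r).2 (AddSubgroup.subset_closure h)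

lemma tmk_add_left {X A : C} (Y : C) (g g' : Val G X Y) (f : Val F Y A) :
    tmk Y (g + g') f = tmk Y g f + tmk Y g' f := by
  have h := tensorMk_eq_of_rel (TensorRel.add_left g g' f)
  rw [sub_sub] at h
  exact sub_eq_zero.1 h

lemma tmk_add_right {X A : C} (Y : C) (g : Val G X Y) (f f' : Val F Y A) :
    tmk Y g (f + f') = tmk Y g f + tmk Y g f' := by
  have h := tensorMk_eq_of_rel (TensorRel.add_right g f f')
  rw [sub_sub] at h
  exact sub_eq_zero.1 h

lemma tmk_push {X A Y Y' : C} (m : Y ⟶ Y') (g : Val G X Y) (f : Val F Y' A) :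
    tmk Y' (push G m g) f = tmk Y g (pull F m f) :=
  sub_eq_zero.1 (tensorMk_eq_of_rel (TensorRel.balanced m g f))

lemma tmk_zero_left {X A : C} (Y : C) (f : Val F Y A) : tmk Y (0 : Val G X Y) f = 0 := by
  have h := tmk_add_left Y (0 : Val G X Y) 0 f
  rwa [add_zero, left_eq_add] at h

lemma push_tmk {X A A' : C} (a : A ⟶ A') (Y : C) (g : Val G X Y) (f : Val F Y A) :
    push (tensor F G) a (tmk Y g f) = tmk Y g (push F a f) := by
  change tmk Y (pull G (𝟙 X) g) (push F a f) = _
  rw [pull_id]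

/-- The generators generate. -/
lemma tensor_induction {X A : C} (S : AddSubgroup (Val (tensor F G) X A))
    (h : ∀ (Y : C) (g : Val G X Y) (f : Val F Y A), tmk Y g f ∈ S) (t : Val (tensor F G) X A) :
    t ∈ S := by
  obtain ⟨t, rfl⟩ := QuotientAddGroup.mk_surjective t
  induction t using FreeAbelianGroup.induction_on with
  | zero => exact S.zero_mem
  | of x => exact h x.1 x.2.1 x.2.2
  | neg x hx => exact S.neg_mem hx
  | add x y hx hy => exact S.add_mem hx hy

/-- The map `g ⊗ f ↦ φ(g, f)` induced by a biadditive balanced family of maps. -/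
def tensorLift {X A : C} {H : Type*} [AddCommGroup H] (φ : ∀ Y, Val G X Y → Val F Y A → H)
    (h1 : ∀ Y g g' f, φ Y (g + g') f = φ Y g f + φ Y g' f)
    (h2 : ∀ Y g f f', φ Y g (f + f') = φ Y g f + φ Y g f')
    (h3 : ∀ {Y Y'} (m : Y ⟶ Y') g f, φ Y' (push G m g) f = φ Y g (pull F m f)) :
    Val (tensor F G) X A →+ H :=
  QuotientAddGroup.lift _ (FreeAbelianGroup.lift fun t => φ t.1 t.2.1 t.2.2)
    ((AddSubgroup.closure_le _).2 (by
      rintro r (⟨g, g', f⟩ | ⟨g, f, f'⟩ | ⟨m, g, f⟩)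
      · simp [h1]
      · simp [h2]
      · simp [h3]))

lemma tensorLift_tmk {X A : C} {H : Type*} [AddCommGroup H] (φ : ∀ Y, Val G X Y → Val F Y A → H)
    (h1 : ∀ Y g g' f, φ Y (g + g') f = φ Y g f + φ Y g' f)
    (h2 : ∀ Y g f f', φ Y g (f + f') = φ Y g f + φ Y g f')
    (h3 : ∀ {Y Y'} (m : Y ⟶ Y') g f, φ Y' (push G m g) f = φ Y g (pull F m f)) (Y : C)
    (g : Val G X Y) (f : Val F Y A) : tensorLift φ h1 h2 h3 (tmk Y g f) = φ Y g f :=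
  FreeAbelianGroup.lift_apply_of _ _

end TensorLeft

variable {C : Type u} [Category.{v} C]

/-- There is a natural surjection `G(X, -) ⟶ G'(X', -)`. -/
def NatSurj (G : Cᵒᵖ ⥤ C ⥤ AddCommGrpCat.{w}) (G' : Cᵒᵖ ⥤ C ⥤ AddCommGrpCat.{w'})
    (X X' : C) : Prop :=
  ∃ φ : ∀ A, Val G X A →+ Val G' X' A, (∀ A, Function.Surjective (φ A)) ∧
    ∀ (A A' : C) (a : A ⟶ A') (g : Val G X A), φ A' (push G a g) = push G' a (φ A g)

/-- Tensoring preserves surjections; naturality is what respects the balancing relation. This is the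
induction step from 𝔼ⁿ to 𝔼ⁿ⁺¹. -/
lemma NatSurj.tensor {F : Cᵒᵖ ⥤ C ⥤ AddCommGrpCat.{w}} {G G' : Cᵒᵖ ⥤ C ⥤ AddCommGrpCat.{w'}}
    {X X' : C} (h : NatSurj G G' X X') : NatSurj (tensor F G) (tensor F G') X X' := by
  obtain ⟨φ, hs, hn⟩ := h
  let ψ : ∀ A, Val (Extri.tensor F G) X A →+ Val (Extri.tensor F G') X' A := fun A =>
    tensorLift (fun Y g f => tmk Y (φ Y g) f)
      (fun Y g g' f => by rw [map_add, tmk_add_left])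
      (fun Y g f f' => tmk_add_right _ _ _ _)
      (fun m g f => by rw [hn, tmk_push])
  have hψ : ∀ A Y (g : Val G X Y) (f : Val F Y A), ψ A (tmk Y g f) = tmk Y (φ Y g) f :=
    fun A Y g f => tensorLift_tmk _ _ _ _ _ _ _
  refine ⟨ψ, fun A t => ?_, fun A A' a t => ?_⟩
  · refine tensor_induction (ψ A).range (fun Y g f => ?_) t
    obtain ⟨g, rfl⟩ := hs Y g
    exact ⟨tmk Y g f, hψ _ _ _ _⟩
  · refine tensor_induction
      (((ψ A').comp (push _ a)).eqLocus ((push _ a).comp (ψ A))) (fun Y g f => ?_) t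
    change ψ A' (push _ a (tmk Y g f)) = push _ a (ψ A (tmk Y g f))
    rw [push_tmk, hψ, hψ, push_tmk]

lemma NatSurj.subsingleton {G : Cᵒᵖ ⥤ C ⥤ AddCommGrpCat.{w}}
    {G' : Cᵒᵖ ⥤ C ⥤ AddCommGrpCat.{w'}} {X X' : C} (h : NatSurj G G' X X')
    (hG : ∀ A, Subsingleton (Val G X A)) (A : C) : Subsingleton (Val G' X' A) := by
  obtain ⟨φ, hs, -⟩ := h
  have := hG A
  exact (hs A).subsingleton

namespace ExtriStr

variable [Preadditive C] [Limits.HasZeroObject C]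
  [Limits.HasBinaryBiproducts C] {𝒞 : ExtriStr.{w} C}

/-! ### Higher extensions and syzygies -/

/-- `𝔼¹(X, A)` is `𝔼(X, A)` in a larger universe. -/
def higherExtOneEquiv (𝒞 : ExtriStr.{w} C) (X A : C) :
    Val (𝒞.higherExt 1) X A ≃+ Val 𝒞.𝔼 X A :=
  AddEquiv.ulift

lemma higherExtOneEquiv_push {X A A' : C} (a : A ⟶ A') (g : Val (𝒞.higherExt 1) X A) :
    𝒞.higherExtOneEquiv X A' (push _ a g) = push _ a (𝒞.higherExtOneEquiv X A g) := rfl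

lemma higherExtOneEquiv_symm_push {X A A' : C} (a : A ⟶ A') (g : Val 𝒞.𝔼 X A) :
    (𝒞.higherExtOneEquiv X A').symm (push _ a g) = push _ a ((𝒞.higherExtOneEquiv X A).symm g) :=
  rfl

/-- Maps inducing the same class differ by one that factors through P, where 𝔼(P, -) = 0. -/
lemma Realizes.pull_eq_pull {A P X Y B : C} {ε : Val 𝒞.𝔼 X A} {x : A ⟶ P} {y : P ⟶ X}
    (h : 𝒞.Realizes ε x y) (hP : 𝒞.IsProjective P) {a a' : A ⟶ Y}
    (ha : push 𝒞.𝔼 a ε = push 𝒞.𝔼 a' ε) (f : Val 𝒞.𝔼 Y B) : pull 𝒞.𝔼 a f = pull 𝒞.𝔼 a' f := by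
  obtain ⟨b, hb⟩ := h.exists_extend (a - a') (by rw [push_sub, ha, sub_self])
  rw [← sub_eq_zero, ← pull_sub, ← hb, pull_comp, hP.eq_zero (pull _ b f), map_zero]

/-- In the base case f ↦ ε ⊗ f is onto: each g is a_*ε, and a_*ε ⊗ f = ε ⊗ a^*f. -/
lemma IsConflation.natSurj_up {Z P X : C} {x : Z ⟶ P} {y : P ⟶ X} (h : 𝒞.IsConflation x y)
    (hP : 𝒞.IsProjective P) (n : ℕ) :
    NatSurj (𝒞.higherExt (n + 1)) (𝒞.higherExt (n + 2)) Z X := by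
  induction n with
  | succ n ih => exact ih.tensor
  | zero =>
    obtain ⟨ε, hε⟩ := h
    let ε' := (𝒞.higherExtOneEquiv X Z).symm ε
    let φ : ∀ A, Val (𝒞.higherExt 1) Z A →+ Val (tensor 𝒞.𝔼 (𝒞.higherExt 1)) X A := fun A =>
      AddMonoidHom.mk' (fun f => tmk Z ε' (𝒞.higherExtOneEquiv Z A f))
        (fun f f' => by rw [map_add, tmk_add_right])
    refine ⟨φ, fun A t => ?_, fun A A' a f => ?_⟩
    · refine tensor_induction (φ A).range (fun Y g f => ?_) t
      obtain ⟨a, ha⟩ := hε.exists_eq_push (𝒞.higherExtOneEquiv X Y g) (hP.eq_zero _)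
      refine ⟨(𝒞.higherExtOneEquiv Z A).symm (pull _ a f), ?_⟩
      have hg : g = push _ a ε' := by
        rw [← higherExtOneEquiv_symm_push, ha, AddEquiv.symm_apply_apply]
      rw [hg, tmk_push]
      change tmk Z ε' _ = _
      rw [AddEquiv.apply_symm_apply]
    · exact (push_tmk _ _ _ _).symm

/-- In the base case g ⊗ f ↦ c^*f, where c_*ε = g; the choice of c is immaterial by
`Realizes.pull_eq_pull`, and ε ⊗ f ↦ f gives surjectivity. -/
lemma IsConflation.natSurj_down {Z P X : C} {x : Z ⟶ P} {y : P ⟶ X} (h : 𝒞.IsConflation x y)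
    (hP : 𝒞.IsProjective P) (n : ℕ) :
    NatSurj (𝒞.higherExt (n + 2)) (𝒞.higherExt (n + 1)) X Z := by
  induction n with
  | succ n ih => exact ih.tensor
  | zero =>
    obtain ⟨ε, hε⟩ := h
    have H : ∀ Y (g : Val (𝒞.higherExt 1) X Y), ∃ a : Z ⟶ Y,
        push 𝒞.𝔼 a ε = 𝒞.higherExtOneEquiv X Y g := fun Y g =>
      hε.exists_eq_push (𝒞.higherExtOneEquiv X Y g) (hP.eq_zero _)
    choose c hc using H
    let φ : ∀ A, Val (tensor 𝒞.𝔼 (𝒞.higherExt 1)) X A →+ Val 𝒞.𝔼 Z A := fun A =>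
      tensorLift (fun Y g f => pull 𝒞.𝔼 (c Y g) f)
        (fun Y g g' f => by
          rw [← 𝒞.biadditive.pull_add]
          refine hε.pull_eq_pull hP ?_ f
          rw [𝒞.biadditive.push_add, hc, hc, hc, map_add])
        (fun Y g f f' => map_add _ _ _)
        (fun {Y Y'} m g f => by
          rw [← pull_comp]
          refine hε.pull_eq_pull hP ?_ f
          rw [push_comp, hc, hc, higherExtOneEquiv_push])
    have hφ : ∀ A Y (g : Val (𝒞.higherExt 1) X Y) (f : Val 𝒞.𝔼 Y A),
        φ A (tmk Y g f) = pull 𝒞.𝔼 (c Y g) f := fun A Y g f => tensorLift_tmk _ _ _ _ _ _ _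
    refine ⟨fun A => (𝒞.higherExtOneEquiv Z A).symm.toAddMonoidHom.comp (φ A), fun A f => ?_,
      fun A A' a t => ?_⟩
    · refine ⟨tmk Z ((𝒞.higherExtOneEquiv X Z).symm ε) (𝒞.higherExtOneEquiv Z A f), ?_⟩
      change (𝒞.higherExtOneEquiv Z A).symm (φ A _) = f
      rw [AddEquiv.symm_apply_eq, hφ]
      refine (hε.pull_eq_pull hP (a' := 𝟙 Z) ?_ _).trans (pull_id _ _)
      rw [hc, push_id, AddEquiv.apply_symm_apply]
    · refine congrArg (𝒞.higherExtOneEquiv Z A').symm (?_ : φ A' _ = push 𝒞.𝔼 a (φ A t))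
      refine tensor_induction
        (((φ A').comp (push _ a)).eqLocus ((push _ a).comp (φ A))) (fun Y g f => ?_) t
      change φ A' (push _ a (tmk Y g f)) = push _ a (φ A (tmk Y g f))
      rw [push_tmk, hφ, hφ, push_pull]

/-- `𝔼ⁿ⁺¹(X, -) = 0`. -/
def ExtVanishesAt (𝒞 : ExtriStr.{w} C) (n : ℕ) (X : C) : Prop :=
  ∀ A : C, Subsingleton (Val (𝒞.higherExt (n + 1)) X A)

lemma extVanishesAt_zero_iff {X : C} : 𝒞.ExtVanishesAt 0 X ↔ 𝒞.IsProjective X := by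
  refine ⟨fun h => isProjective_of_eq_zero fun A δ => ?_, fun h A => ⟨fun a b => ?_⟩⟩
  · have := h A
    exact (𝒞.higherExtOneEquiv X A).symm.injective (Subsingleton.elim _ _)
  · exact (𝒞.higherExtOneEquiv X A).injective ((h.eq_zero _).trans (h.eq_zero _).symm)

/-- Only vanishing is compared, so surjections in both directions suffice; they need not be inverse
to each other. -/
lemma IsConflation.extVanishesAt_succ_iff {Z P X : C} {x : Z ⟶ P} {y : P ⟶ X}
    (h : 𝒞.IsConflation x y) (hP : 𝒞.IsProjective P) (n : ℕ) :
    𝒞.ExtVanishesAt (n + 1) X ↔ 𝒞.ExtVanishesAt n Z :=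
  ⟨(h.natSurj_down hP n).subsingleton, (h.natSurj_up hP n).subsingleton⟩

lemma HigherExtVanishes.succ {n : ℕ} (h : 𝒞.HigherExtVanishes (n + 1)) :
    𝒞.HigherExtVanishes (n + 2) := fun X A => by
  refine subsingleton_of_forall_eq (0 : Val (tensor 𝒞.𝔼 (𝒞.higherExt (n + 1))) X A) fun t => ?_
  refine AddSubgroup.mem_bot.1 (tensor_induction ⊥ (fun Y g f => ?_) t)
  have := h X Y
  rw [Subsingleton.elim g 0]
  exact tmk_zero_left _ _

lemma HigherExtVanishes.mono {m n : ℕ} (hmn : m ≤ n) (h : 𝒞.HigherExtVanishes (m + 1)) :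
    𝒞.HigherExtVanishes (n + 1) := by
  induction n, hmn using Nat.le_induction with
  | base => exact h
  | succ n _ ih => exact ih.succ

lemma posGlobalDim_le_iff {n : ℕ} : 𝒞.posGlobalDim ≤ n ↔ 𝒞.HigherExtVanishes (n + 1) := by
  refine ⟨fun h => ?_, fun h => sInf_le ⟨n, rfl, h⟩⟩
  -- The infimum of the empty set is ∞, so a finite bound forces the infimum to be attained.
  have hne : {m : ℕ∞ | ∃ k : ℕ, m = k ∧ 𝒞.HigherExtVanishes (k + 1)}.Nonempty := by
    rw [Set.nonempty_iff_ne_empty]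
    intro he
    rw [posGlobalDim, he, sInf_empty] at h
    exact absurd h (by simp)
  obtain ⟨k, hk, hv⟩ := csInf_mem hne
  have hk' : 𝒞.posGlobalDim = k := hk
  rw [hk'] at h
  exact hv.mono (by exact_mod_cast h)

/-- `Z` is the last term of `n` consecutive conflations with projective middle terms. -/
def IsSyzygy (𝒞 : ExtriStr.{w} C) : ℕ → C → Prop
  | 0, _ => True
  | n + 1, Z => ∃ (P Z' : C) (x : Z ⟶ P) (y : P ⟶ Z'), 𝒞.IsConflation x y ∧
      𝒞.IsProjective P ∧ IsSyzygy 𝒞 n Z'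

/-- `W` is the last term of `n` consecutive conflations with injective middle terms. -/
def IsCosyzygy (𝒞 : ExtriStr.{w} C) : ℕ → C → Prop
  | 0, _ => True
  | n + 1, W => ∃ (W' I : C) (x : W' ⟶ I) (y : I ⟶ W), 𝒞.IsConflation x y ∧
      𝒞.IsInjective I ∧ IsCosyzygy 𝒞 n W'

lemma IsSyzygy.extVanishesAt {n : ℕ} : ∀ {k : ℕ} {Z : C}, 𝒞.IsSyzygy n Z →
    (∀ X, 𝒞.ExtVanishesAt (n + k) X) → 𝒞.ExtVanishesAt k Z := by
  induction n with
  | zero => intro k Z _ h; simpa using h Z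
  | succ n ih =>
    rintro k Z ⟨P, Z', x, y, h, hP, hZ'⟩ hv
    exact (h.extVanishesAt_succ_iff hP k).1 (ih hZ' fun X => by
      rw [← Nat.succ_add_eq_add_succ]; exact hv X)

/-- Induction on j, replacing Z by a further syzygy; the case k = 0 covers every object. -/
lemma EnoughProjectives.extVanishesAt (hE : 𝒞.EnoughProjectives) {n : ℕ}
    (hn : ∀ Z, 𝒞.IsSyzygy n Z → 𝒞.IsProjective Z) : ∀ {j k : ℕ} {Z : C}, j + k = n →
    𝒞.IsSyzygy k Z → 𝒞.ExtVanishesAt j Z := by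
  intro j
  induction j with
  | zero =>
    intro k Z hk hZ
    rw [zero_add] at hk
    exact extVanishesAt_zero_iff.2 (hn Z (hk ▸ hZ))
  | succ j ih =>
    intro k Z hk hZ
    obtain ⟨A, P, x, y, h, hP⟩ := hE Z
    exact (h.extVanishesAt_succ_iff hP j).2 (ih (k := k + 1) (by omega) ⟨P, Z, x, y, h, hP, hZ⟩)

lemma EnoughProjectives.posGlobalDim_le_iff (hE : 𝒞.EnoughProjectives) {n : ℕ} :
    𝒞.posGlobalDim ≤ n ↔ ∀ Z, 𝒞.IsSyzygy n Z → 𝒞.IsProjective Z := by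
  rw [ExtriStr.posGlobalDim_le_iff]
  refine ⟨fun h Z hZ => extVanishesAt_zero_iff.1 (hZ.extVanishesAt fun X => h X), fun h X =>
    hE.extVanishesAt h (add_zero n) (Z := X) trivial⟩

end ExtriStr

end Extri

namespace Extri

namespace ExtriStr

variable {C : Type u} [Category.{v} C] [Preadditive C] [Limits.HasZeroObject C]
  [Limits.HasBinaryBiproducts C] {𝒞 : ExtriStr.{w} C}

open scoped ZeroObject

/-! ### Composition of inflations and deflations -/

lemma IsConflation.comp_inflation {A B D M F : C} {f : A ⟶ B} {f' : B ⟶ D} {g : B ⟶ M}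
    {g' : M ⟶ F} (h : 𝒞.IsConflation f f') (h' : 𝒞.IsConflation g g') :
    ∃ (E : C) (k : M ⟶ E) (d : D ⟶ E) (e : E ⟶ F), 𝒞.IsConflation (f ≫ g) k ∧
      𝒞.IsConflation d e := by
  obtain ⟨δ, hδ⟩ := h
  obtain ⟨δ', hδ'⟩ := h'
  obtain ⟨E, k, d, e, δ'', h1, h2, -⟩ := 𝒞.et4 hδ hδ'
  exact ⟨E, k, d, e, ⟨_, h1⟩, ⟨_, h2⟩⟩

lemma IsConflation.comp_deflation {D A B F M : C} {f' : D ⟶ A} {f : A ⟶ B} {g' : F ⟶ B}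
    {g : B ⟶ M} (h : 𝒞.IsConflation f' f) (h' : 𝒞.IsConflation g' g) :
    ∃ (E : C) (k : E ⟶ A), 𝒞.IsConflation k (f ≫ g) := by
  obtain ⟨δ, hδ⟩ := h
  obtain ⟨δ', hδ'⟩ := h'
  obtain ⟨E, k, d, e, δ'', h1, -⟩ := 𝒞.et4op hδ hδ'
  exact ⟨E, k, _, h1⟩

lemma IsConflation.realizes_zero_of_isInjective {I M X : C} {x : I ⟶ M} {y : M ⟶ X}
    (h : 𝒞.IsConflation x y) (hI : 𝒞.IsInjective I) : 𝒞.Realizes (0 : Val 𝒞.𝔼 X I) x y := by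
  obtain ⟨δ, hδ⟩ := h
  rwa [hI.eq_zero δ] at hδ

/-! ### Injective coresolutions -/

/-- There are `n` conflations `Yᵏ ⟶ Iᵏ ⟶ Yᵏ⁺¹`, `0 ≤ k < n`, with `Y⁰ = Y` and every `Iᵏ`
injective. -/
def HasInjCoresolution (𝒞 : ExtriStr.{w} C) : ℕ → C → Prop
  | 0, _ => True
  | n + 1, Y => ∃ (I Y' : C) (f : Y ⟶ I) (g : I ⟶ Y'), 𝒞.IsConflation f g ∧
      𝒞.IsInjective I ∧ HasInjCoresolution 𝒞 n Y'

lemma IsInjective.hasInjCoresolution (n : ℕ) {I : C} (hI : 𝒞.IsInjective I) :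
    𝒞.HasInjCoresolution n I := by
  induction n generalizing I with
  | zero => trivial
  | succ n ih => exact ⟨I, 0, 𝟙 I, 0, ⟨_, 𝒞.realizes_id_zero I⟩, hI, ih isInjective_zero⟩

/-- Objects with injective coresolutions are closed under extensions. -/
lemma HasInjCoresolution.extension {n : ℕ} {A B X : C} {x : A ⟶ B} {y : B ⟶ X}
    (h : 𝒞.IsConflation x y) (hA : 𝒞.HasInjCoresolution n A) (hX : 𝒞.HasInjCoresolution n X) :
    𝒞.HasInjCoresolution n B := by
  induction n generalizing A B X with
  | zero => trivial
  | succ n ih =>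
    obtain ⟨I, A', i, p, hi, hI, hA'⟩ := hA
    obtain ⟨K, X', k, q, hk, hK, hX'⟩ := hX
    -- M has conflations B ⟶ M ⟶ A' and I ⟶ M ⟶ X. The latter splits, so M embeds in I ⊞ K with cone
    -- X', and the cone of B ⟶ I ⊞ K is an extension of X' by A'.
    obtain ⟨M, b, c, b', c', hb, hb'⟩ := exists_pushout h hi
    obtain ⟨m, t, hm⟩ := exists_isConflation_biprod (hb'.realizes_zero_of_isInjective hI) hk
    obtain ⟨Q, l, r, s, hl, hr⟩ := hb.comp_inflation hm
    exact ⟨I ⊞ K, Q, _, l, hl, hI.biprod hK, ih hr hA' hX'⟩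

/-- Objects with injective coresolutions are closed under cones of inflations. -/
lemma HasInjCoresolution.cone {A B X : C} {x : A ⟶ B} {y : B ⟶ X}
    (h : 𝒞.IsConflation x y) (hA : ∀ n, 𝒞.HasInjCoresolution n A)
    (hB : ∀ n, 𝒞.HasInjCoresolution n B) : ∀ n, 𝒞.HasInjCoresolution n X
  | 0 => trivial
  | n + 1 => by
    -- One extra step is needed for A, which is why the hypotheses cover all lengths.
    obtain ⟨I, Y, i, p, hi, hI, K, Y', k, q, hk, hK, hY'⟩ := hA (n + 2)
    obtain ⟨J, B', j, r, hj, hJ, hB'⟩ := hB (n + 1)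
    obtain ⟨M, b, c, b', c', hb, hb'⟩ := exists_pushout h hi
    -- M splits as I ⊕ X, so X is also a subobject with cone I. Pushing B ⟶ M out along B ⟶ J gives
    -- N = J ⊕ Y, which embeds in J ⊞ K. The cone of X ⟶ M ⟶ J ⊞ K is then built by extensions from
    -- I, B' and Y'.
    obtain ⟨s, t, hst⟩ := (hb'.realizes_zero_of_isInjective hI).exists_swap
    obtain ⟨N, a, d, a', d', ha, ha'⟩ := exists_pushout hb hj
    obtain ⟨m, e, hm⟩ := exists_isConflation_biprod (ha'.realizes_zero_of_isInjective hJ) hk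
    obtain ⟨Q, l, f, g, hl, hf⟩ := ha.comp_inflation hm
    obtain ⟨Q', l', f', g', hl', hf'⟩ := IsConflation.comp_inflation ⟨_, hst⟩ hl
    exact ⟨J ⊞ K, Q', _, l', hl', hJ.biprod hK,
      (hI.hasInjCoresolution n).extension hf' (hB'.extension hf hY')⟩

/-! ### Vanishing of extensions of syzygies -/

/-- Each step removes one cosyzygy from W and takes one more syzygy of Z; at the end Z has become a
syzygy of order n + k, hence projective. -/
lemma IsCosyzygy.eq_zero (hE : 𝒞.EnoughProjectives) : ∀ {n k : ℕ} {W : C}, 𝒞.IsCosyzygy n W →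
    (∀ Z, 𝒞.IsSyzygy (n + k) Z → 𝒞.IsProjective Z) → ∀ {Z : C}, 𝒞.IsSyzygy k Z →
    ∀ δ : Val 𝒞.𝔼 Z W, δ = 0
  | 0, k, W, _, h, Z, hZ, δ => (h Z (by rwa [zero_add])).eq_zero δ
  | n + 1, k, W, ⟨W', I, i, p, hi, hI, hW'⟩, h, Z, hZ, δ => by
    obtain ⟨A, P, x, y, hx, hP⟩ := hE Z
    refine eq_zero_shift_up hx hP hi hI (hW'.eq_zero hE (k := k + 1) (fun Z hZ => h Z ?_)
      ⟨P, Z, x, y, hx, hP, hZ⟩) δ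
    rwa [Nat.succ_add_eq_add_succ]

lemma IsCosyzygy.isInjective (hE : 𝒞.EnoughProjectives) {n : ℕ} {W : C}
    (hn : ∀ Z, 𝒞.IsSyzygy n Z → 𝒞.IsProjective Z) (hW : 𝒞.IsCosyzygy n W) : 𝒞.IsInjective W :=
  isInjective_of_eq_zero fun _ δ => hW.eq_zero hE (k := 0) hn trivial δ

/-- The term left after n steps is a cosyzygy of order n + m, hence injective, and the coresolution
continues trivially. -/
lemma HasProjInjCoresolution.hasInjCoresolution {n m : ℕ} {Y : C}
    (h : 𝒞.HasProjInjCoresolution n Y) (hY : 𝒞.IsCosyzygy m Y)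
    (hm : ∀ W, 𝒞.IsCosyzygy (n + m) W → 𝒞.IsInjective W) (k : ℕ) :
    𝒞.HasInjCoresolution k Y := by
  induction n generalizing m Y k with
  | zero => exact (hm Y (by rwa [zero_add])).hasInjCoresolution k
  | succ n ih =>
    obtain ⟨I, Y', f, g, hf, -, hI, hY'⟩ := h
    cases k with
    | zero => trivial
    | succ k =>
      refine ⟨I, Y', f, g, hf, hI, ih hY' (m := m + 1) ⟨Y, I, f, g, hf, hI, hY⟩ ?_ k⟩
      rwa [← Nat.succ_add_eq_add_succ]

lemma HasProjInjCoresolution.mono {m n : ℕ} (hmn : m ≤ n) {Y : C}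
    (h : 𝒞.HasProjInjCoresolution n Y) : 𝒞.HasProjInjCoresolution m Y := by
  induction m generalizing n Y with
  | zero => trivial
  | succ m ih =>
    cases n with
    | zero => omega
    | succ n =>
      obtain ⟨I, Y', f, g, hf, hP, hI, hY'⟩ := h
      exact ⟨I, Y', f, g, hf, hP, hI, ih (by omega) hY'⟩

/-- If projective objects have coresolutions by `n` projective-injective objects and syzygies of
order `n` are projective, every object has injective coresolutions of any length. -/
lemma EnoughProjectives.hasInjCoresolution (hE : 𝒞.EnoughProjectives) {n : ℕ}
    (hn : ∀ Z, 𝒞.IsSyzygy n Z → 𝒞.IsProjective Z)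
    (hP : ∀ P, 𝒞.IsProjective P → 𝒞.HasProjInjCoresolution n P) {j k : ℕ} (hjk : j + k = n)
    {Z : C} (hZ : 𝒞.IsSyzygy k Z) : ∀ m, 𝒞.HasInjCoresolution m Z := by
  have H : ∀ P, 𝒞.IsProjective P → ∀ m, 𝒞.HasInjCoresolution m P := fun P h m =>
    (hP P h).hasInjCoresolution (m := 0) trivial (fun W hW => hW.isInjective hE hn) m
  induction j generalizing k Z with
  | zero =>
    rw [zero_add] at hjk
    exact H Z (hn Z (hjk ▸ hZ))
  | succ j ih =>
    obtain ⟨A, P, x, y, h, hP'⟩ := hE Z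
    -- Z is the cone of its syzygy, handled by induction, in a projective object.
    exact HasInjCoresolution.cone h
      (ih (k := k + 1) (by omega) ⟨P, Z, x, y, h, hP', hZ⟩) (H P hP')

/-! ### Resolutions by projective-injective objects -/

/-- `M` is a quotient of a projective-injective object if `𝔼(Y, M) = 0` for the cosyzygies `Y`
of projective objects. -/
lemma EnoughProjectives.exists_deflation (hE : 𝒞.EnoughProjectives) {n m : ℕ} (hmn : m ≤ n)
    (hP : ∀ P, 𝒞.IsProjective P → 𝒞.HasProjInjCoresolution (n + 1) P) {M : C}
    (hM : ∀ Y, 𝒞.HasProjInjCoresolution m Y → ∀ δ : Val 𝒞.𝔼 Y M, δ = 0) :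
    ∃ (K I : C) (f : K ⟶ I) (g : I ⟶ M), 𝒞.IsConflation f g ∧ 𝒞.IsProjective I ∧
      𝒞.IsInjective I := by
  obtain ⟨A, P, x, y, ⟨δ, hδ⟩, hP'⟩ := hE M
  obtain ⟨I, Y, f, g, ⟨ε, hε⟩, hIP, hI, hY⟩ := hP P hP'
  -- (ET4) gives a deflation I ⟶ E and a conflation M ⟶ E ⟶ Y. The latter splits by `hM`, so I ⟶ E ⟶
  -- M is a deflation.
  obtain ⟨E, k, d, e, δ'', h1, h2, -⟩ := 𝒞.et4 hδ hε
  rw [hM Y (hY.mono hmn) (push 𝒞.𝔼 y ε)] at h2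
  obtain ⟨s, r, hr⟩ := h2.exists_swap
  obtain ⟨K, i, hi⟩ := IsConflation.comp_deflation ⟨_, h1⟩ ⟨_, hr⟩
  exact ⟨K, I, i, _, hi, hIP, hI⟩

/-- By `eq_zero_shift_down` the vanishing condition passes from M with m to the kernel K with m + 1.
The bound m + r ≤ n + 1 keeps m ≤ n whenever another deflation is needed. -/
lemma EnoughProjectives.hasProjInjResolution (hE : 𝒞.EnoughProjectives) {n : ℕ}
    (hP : ∀ P, 𝒞.IsProjective P → 𝒞.HasProjInjCoresolution (n + 1) P) {r m : ℕ}
    (hr : m + r ≤ n + 1) {M : C}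
    (hM : ∀ Y, 𝒞.HasProjInjCoresolution m Y → ∀ δ : Val 𝒞.𝔼 Y M, δ = 0) :
    𝒞.HasProjInjResolution r M := by
  induction r generalizing m M with
  | zero => trivial
  | succ r ih =>
    obtain ⟨K, I, f, g, hf, hIP, hI⟩ := hE.exists_deflation (by omega : m ≤ n) hP hM
    refine ⟨K, I, f, g, hf, hIP, hI, ih (m := m + 1) (by omega) ?_⟩
    rintro Y ⟨J, Y', a, b, ha, hJP, -, hY'⟩
    exact eq_zero_shift_down ha hJP hf hI (hM Y' hY')

/-! ### Duality -/

lemma le_domDim_iff {n : ℕ} : (n : ℕ∞) + 1 ≤ 𝒞.domDim ↔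
    ∀ P, 𝒞.IsProjective P → 𝒞.HasProjInjCoresolution (n + 1) P := by
  refine ⟨fun h P hP => ?_, fun h => le_sSup ⟨n + 1, by simp, h⟩⟩
  obtain ⟨_, ⟨k, rfl, hk⟩, hn⟩ := lt_sSup_iff.1
    (((ENat.lt_add_one_iff (ENat.natCast_ne_top n)).2 le_rfl).trans_le h)
  exact (hk P hP).mono (by exact_mod_cast hn)

variable (𝒞) in
lemma op_isProjective_iff (P : Cᵒᵖ) : 𝒞.op.IsProjective P ↔ 𝒞.IsInjective P.unop := by
  refine ⟨fun h A B X x y hx c => ?_, fun h A B X x y hx c => ?_⟩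
  · obtain ⟨b, hb⟩ := h (A := Opposite.op X) (B := Opposite.op B) (X := Opposite.op A) y.op x.op
      hx c.op
    exact ⟨b.unop, congrArg Quiver.Hom.unop hb⟩
  · obtain ⟨b, hb⟩ := h y.unop x.unop hx c.unop
    exact ⟨b.op, Quiver.Hom.unop_inj hb⟩

variable (𝒞) in
lemma op_isInjective_iff (P : Cᵒᵖ) : 𝒞.op.IsInjective P ↔ 𝒞.IsProjective P.unop := by
  refine ⟨fun h A B X x y hx c => ?_, fun h A B X x y hx c => ?_⟩
  · obtain ⟨b, hb⟩ := h (A := Opposite.op X) (B := Opposite.op B) (X := Opposite.op A) y.op x.op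
      hx c.op
    exact ⟨b.unop, congrArg Quiver.Hom.unop hb⟩
  · obtain ⟨b, hb⟩ := h y.unop x.unop hx c.unop
    exact ⟨b.op, Quiver.Hom.unop_inj hb⟩

lemma op_enoughProjectives_iff : 𝒞.op.EnoughProjectives ↔ 𝒞.EnoughInjectives := by
  refine ⟨fun h X => ?_, fun h X => ?_⟩
  · obtain ⟨A, P, x, y, hx, hP⟩ := h (Opposite.op X)
    exact ⟨P.unop, A.unop, y.unop, x.unop, hx, (𝒞.op_isProjective_iff P).1 hP⟩
  · obtain ⟨I, A, x, y, hx, hI⟩ := h X.unop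
    exact ⟨Opposite.op A, Opposite.op I, y.op, x.op, hx, (𝒞.op_isProjective_iff _).2 hI⟩

lemma op_enoughInjectives_iff : 𝒞.op.EnoughInjectives ↔ 𝒞.EnoughProjectives := by
  refine ⟨fun h X => ?_, fun h X => ?_⟩
  · obtain ⟨P, A, x, y, hx, hP⟩ := h (Opposite.op X)
    exact ⟨A.unop, P.unop, y.unop, x.unop, hx, (𝒞.op_isInjective_iff P).1 hP⟩
  · obtain ⟨A, I, x, y, hx, hI⟩ := h X.unop
    exact ⟨Opposite.op I, Opposite.op A, y.op, x.op, hx, (𝒞.op_isInjective_iff _).2 hI⟩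

lemma op_isSyzygy_iff {n : ℕ} {Z : Cᵒᵖ} : 𝒞.op.IsSyzygy n Z ↔ 𝒞.IsCosyzygy n Z.unop := by
  induction n generalizing Z with
  | zero => exact Iff.rfl
  | succ n ih =>
    constructor
    · rintro ⟨P, Z', x, y, hx, hP, hZ'⟩
      exact ⟨Z'.unop, P.unop, y.unop, x.unop, hx, (𝒞.op_isProjective_iff P).1 hP, ih.1 hZ'⟩
    · rintro ⟨Z', P, x, y, hx, hP, hZ'⟩
      exact ⟨Opposite.op P, Opposite.op Z', y.op, x.op, hx, (𝒞.op_isProjective_iff _).2 hP,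
        ih.2 hZ'⟩

lemma op_isCosyzygy_iff {n : ℕ} {Z : Cᵒᵖ} : 𝒞.op.IsCosyzygy n Z ↔ 𝒞.IsSyzygy n Z.unop := by
  induction n generalizing Z with
  | zero => exact Iff.rfl
  | succ n ih =>
    constructor
    · rintro ⟨Z', P, x, y, hx, hP, hZ'⟩
      exact ⟨P.unop, Z'.unop, y.unop, x.unop, hx, (𝒞.op_isInjective_iff P).1 hP, ih.1 hZ'⟩
    · rintro ⟨P, Z', x, y, hx, hP, hZ'⟩
      exact ⟨Opposite.op Z', Opposite.op P, y.op, x.op, hx, (𝒞.op_isInjective_iff _).2 hP,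
        ih.2 hZ'⟩

lemma op_hasProjInjCoresolution_iff {n : ℕ} {Y : Cᵒᵖ} :
    𝒞.op.HasProjInjCoresolution n Y ↔ 𝒞.HasProjInjResolution n Y.unop := by
  induction n generalizing Y with
  | zero => exact Iff.rfl
  | succ n ih =>
    constructor
    · rintro ⟨I, Y', x, y, hx, hP, hI, hY'⟩
      exact ⟨Y'.unop, I.unop, y.unop, x.unop, hx, (𝒞.op_isInjective_iff I).1 hI,
        (𝒞.op_isProjective_iff I).1 hP, ih.1 hY'⟩
    · rintro ⟨Y', I, x, y, hx, hP, hI, hY'⟩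
      exact ⟨Opposite.op I, Opposite.op Y', y.op, x.op, hx, (𝒞.op_isProjective_iff _).2 hI,
        (𝒞.op_isInjective_iff _).2 hP, ih.2 hY'⟩

lemma op_hasProjInjResolution_iff {n : ℕ} {Y : Cᵒᵖ} :
    𝒞.op.HasProjInjResolution n Y ↔ 𝒞.HasProjInjCoresolution n Y.unop := by
  induction n generalizing Y with
  | zero => exact Iff.rfl
  | succ n ih =>
    constructor
    · rintro ⟨Y', I, x, y, hx, hP, hI, hY'⟩
      exact ⟨I.unop, Y'.unop, y.unop, x.unop, hx, (𝒞.op_isInjective_iff I).1 hI,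
        (𝒞.op_isProjective_iff I).1 hP, ih.1 hY'⟩
    · rintro ⟨I, Y', x, y, hx, hP, hI, hY'⟩
      exact ⟨Opposite.op Y', Opposite.op I, y.op, x.op, hx, (𝒞.op_isProjective_iff _).2 hI,
        (𝒞.op_isInjective_iff _).2 hP, ih.2 hY'⟩

lemma isAuslander_iff {d : ℕ} : 𝒞.IsAuslander d ↔ 𝒞.EnoughProjectives ∧
    (∀ Z, 𝒞.IsSyzygy (d + 1) Z → 𝒞.IsProjective Z) ∧
    ∀ P, 𝒞.IsProjective P → 𝒞.HasProjInjCoresolution (d + 1) P :=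
  ⟨fun h => ⟨h.1, h.1.posGlobalDim_le_iff.1 (by exact_mod_cast h.2), le_domDim_iff.1 h.3⟩,
    fun h => ⟨h.1, by exact_mod_cast h.1.posGlobalDim_le_iff.2 h.2.1, le_domDim_iff.2 h.2.2⟩⟩

lemma op_isAuslander_iff {d : ℕ} : 𝒞.op.IsAuslander d ↔ 𝒞.EnoughInjectives ∧
    (∀ W, 𝒞.IsCosyzygy (d + 1) W → 𝒞.IsInjective W) ∧
    ∀ I, 𝒞.IsInjective I → 𝒞.HasProjInjResolution (d + 1) I := by
  rw [isAuslander_iff, op_enoughProjectives_iff]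
  refine and_congr_right fun _ => and_congr ⟨fun h W hW => ?_, fun h Z hZ => ?_⟩
    ⟨fun h I hI => ?_, fun h P hP => ?_⟩
  · exact (𝒞.op_isProjective_iff _).1 (h (Opposite.op W) (op_isSyzygy_iff.2 hW))
  · exact (𝒞.op_isProjective_iff _).2 (h _ (op_isSyzygy_iff.1 hZ))
  · exact op_hasProjInjCoresolution_iff.1 (h (Opposite.op I) ((𝒞.op_isProjective_iff _).2 hI))
  · exact op_hasProjInjCoresolution_iff.2 (h _ ((𝒞.op_isProjective_iff _).1 hP))

/-- The opposite of a `d`-Auslander category is `d`-Auslander. -/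
lemma IsAuslander.op {d : ℕ} (h : 𝒞.IsAuslander d) : 𝒞.op.IsAuslander d := by
  obtain ⟨hE, hn, hP⟩ := isAuslander_iff.1 h
  refine op_isAuslander_iff.2 ⟨fun X => ?_, fun W hW => hW.isInjective hE hn, fun I hI =>
    hE.hasProjInjResolution hP (zero_add _).le fun Y _ δ => hI.eq_zero δ⟩
  -- Every object is a syzygy of order 0; one step of its coresolution gives enough injectives.
  obtain ⟨I, Y, f, g, hf, hI, -⟩ :=
    hE.hasInjCoresolution hn hP (add_zero _) (Z := X) trivial 1
  exact ⟨I, Y, f, g, hf, hI⟩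

/-- A category is `d`-Auslander if its opposite is `d`-Auslander. -/
lemma IsAuslander.of_op {d : ℕ} (h : 𝒞.op.IsAuslander d) : 𝒞.IsAuslander d := by
  -- Dualizing twice yields conditions on the injectives of `𝒞.op`, which are conditions on the
  -- projectives of `𝒞`; no identification of the double opposite with `𝒞` is needed.
  obtain ⟨hE, hn, hP⟩ := op_isAuslander_iff.1 h.op
  refine isAuslander_iff.2 ⟨op_enoughInjectives_iff.1 hE, fun Z hZ => ?_, fun P hP' => ?_⟩
  · exact (𝒞.op_isInjective_iff _).1 (hn (Opposite.op Z) (op_isCosyzygy_iff.2 hZ))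
  · exact op_hasProjInjResolution_iff.1 (hP (Opposite.op P) ((𝒞.op_isInjective_iff _).2 hP'))

end ExtriStr

end Extri

theorem mainTheorem9 {C : Type u} [Category.{v} C] [Preadditive C] [Limits.HasZeroObject C]
    [Limits.HasBinaryBiproducts C] (𝒞 : Extri.ExtriStr.{w} C) (d : ℕ) (hd : 1 ≤ d) :
    (𝒞.IsAuslander d ↔ 𝒞.op.IsAuslander d) ∧
      (𝒞.IsAuslander d → 𝒞.EnoughInjectives ∧ (d + 1 : ℕ∞) ≤ 𝒞.codomDim) := by
  refine ⟨⟨fun h => h.op, fun h => h.of_op⟩, fun h => ?_⟩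
  obtain ⟨hI, -, hr⟩ := Extri.ExtriStr.op_isAuslander_iff.1 h.op
  exact ⟨hI, le_sSup ⟨d + 1, by simp, hr⟩⟩
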